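/- Let $(\Omega,\Sigma)$ be a measurable space and $\mathbb P$ an atomless probability measure on $\Sigma$. Let $B(\Sigma)$ be the set of bounded real-valued random variables, and write $X\sim_{\mathbb P}Y$ if $X$ and $Y$ have the same distribution under $\mathbb P$. Let $\mathbf{ba}$ be the space of bounded signed charges on $\Sigma$ (finitely additive set functions $\mu\colon\Sigma\to\mathbb R$ with $\sup_{A\in\Sigma}|\mu(A)|<\infty$) and $\mathbf{ca}\subseteq\mathbf{ba}$ the subspace of countably additive signed measures, both with the setwise order ($\mu\le\nu$ if $\mu(A)\le\nu(A)$ for all $A\in\Sigma$). For $\mu\in\mathbf{ba}$ and $X\in B(\Sigma)$ let $\mathbb E_\mu[X]$ be the Dunford--Schwartz integral. Let $\mathcal D\subseteq B(\Sigma)$ be nonempty and $\mathbb P$-invariant, i.e. $X\in\mathcal D$, $Y\in B(\Sigma)$ and $X\sim_{\mathbb P}Y$ imply $Y\in\mathcal D$, and let $\varphi\colon\mathcal D\to\mathbb R$ be $\mathbb P$-invariant, i.e. $\varphi(X)=\varphi(Y)$ for all $X,Y\in\mathcal D$ with $X\sim_{\mathbb P}Y$. Put $$\mathcal L=\{\mu\in\mathbf{ca}\mid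 \forall X\in\mathcal D:\ \mathbb E_\mu[X]\le\varphi(X)\},\qquad \mathcal U=\{\mu\in\mathbf{ca}\mid \forall X\in\mathcal D:\ \mathbb E_\mu[X]\ge\varphi(X)\},$$ $$\mathcal L^f=\{\mu\in\mathbf{ba}\mid \forall X\in\mathcal D:\ \mathbb E_\mu[X]\le\varphi(X)\},\qquad \mathcal U^f=\{\mu\in\mathbf{ba}\mid \forall X\in\mathcal D:\ \mathbb E_\mu[X]\ge\varphi(X)\}.$$ (i) $\sup\mathcal L^f$ exists in $\mathbf{ba}$ if and only if $\sup\mathcal L$ exists in $\mathbf{ca}$, in which case there is a constant $a\in\mathbb R$ such that $a\mathbb P=\sup\mathcal L=\sup\mathcal L^f\in\mathbf{ca}$. (ii) Likewise, $\inf\mathcal U^f$ exists in $\mathbf{ba}$ if and only if $\inf\mathcal U$ exists in $\mathbf{ca}$, in which case there is a constant $b\in\mathbb R$ such that $b\mathbb P=\inf\mathcal U=\inf\mathcal U^f\in\mathbf{ca}$. -/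

import Mathlib

open MeasureTheory Filter Topology

noncomputable section

/-- The space `ba` of a σ-algebra: signed charges (finitely additive real set functions on the
measurable sets) that are bounded. As for Mathlib's `VectorMeasure`, the value on a set that is
not measurable is fixed to be `0`, so that a charge is determined by its values on the σ-algebra. -/
@[ext]
structure BoundedCharge (Ω : Type*) [MeasurableSpace Ω] where
  /-- the underlying set function -/
  toFun : Set Ω → ℝ
  not_measurable' : ∀ A, ¬ MeasurableSet A → toFun A = 0
  add' : ∀ A B, MeasurableSet A → MeasurableSet B → Disjoint A B →
    toFun (A ∪ B) = toFun A + toFun B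
  bounded' : ∃ C : ℝ, ∀ A, MeasurableSet A → |toFun A| ≤ C

/-- The space `B(Σ)` of bounded real-valued random variables. -/
structure BoundedRV (Ω : Type*) [MeasurableSpace Ω] where
  /-- the underlying function -/
  toFun : Ω → ℝ
  measurable' : Measurable toFun
  bounded' : ∃ C : ℝ, ∀ ω, |toFun ω| ≤ C

variable {Ω : Type*} [MeasurableSpace Ω]

namespace BoundedCharge

/-- The setwise order on `ba`. -/
instance : PartialOrder (BoundedCharge Ω) where
  le μ ν := ∀ A, MeasurableSet A → μ.toFun A ≤ ν.toFun A
  le_refl _ _ _ := le_rfl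
  le_trans _ _ _ h₁ h₂ A hA := (h₁ A hA).trans (h₂ A hA)
  le_antisymm μ ν h₁ h₂ := by
    apply BoundedCharge.ext
    funext A
    by_cases hA : MeasurableSet A
    · exact le_antisymm (h₁ A hA) (h₂ A hA)
    · rw [μ.not_measurable' A hA, ν.not_measurable' A hA]

/-- The integral `∑ₓ x μ(s = x)` of a simple random variable `s` with respect to `μ`. -/
def simpleIntegral (μ : BoundedCharge Ω) (s : SimpleFunc Ω ℝ) : ℝ :=
  ∑ x ∈ s.range, x * μ.toFun (s ⁻¹' {x})

end BoundedCharge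

/-- The filter of simple random variables that converge uniformly to `X`. -/
def BoundedRV.uniformApprox (X : BoundedRV Ω) : Filter (SimpleFunc Ω ℝ) :=
  ⨅ ε : Set.Ioi (0 : ℝ), 𝓟 {s | ∀ ω, |X.toFun ω - s ω| ≤ ε}

/-- The (Dunford–Schwartz) integral `𝔼_μ[X]` of a bounded random variable with respect to `μ ∈ ba`:
the limit of the integrals of simple random variables that converge uniformly to `X`. The limit
exists, see `BoundedCharge.tendsto_simpleIntegral`. -/
def BoundedCharge.expect (μ : BoundedCharge Ω) (X : BoundedRV Ω) : ℝ :=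
  limUnder X.uniformApprox μ.simpleIntegral

theorem BoundedRV.hasBasis_uniformApprox (X : BoundedRV Ω) :
    X.uniformApprox.HasBasis (fun ε : ℝ => 0 < ε)
      (fun ε => {s | ∀ ω, |X.toFun ω - s ω| ≤ ε}) := by
  unfold BoundedRV.uniformApprox
  have : Nonempty (Set.Ioi (0 : ℝ)) := ⟨⟨1, Set.mem_Ioi.2 one_pos⟩⟩
  have h := hasBasis_iInf_principal
    (s := fun ε : Set.Ioi (0 : ℝ) => {s : SimpleFunc Ω ℝ | ∀ ω, |X.toFun ω - s ω| ≤ ε}) (by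
      intro a b
      refine ⟨min a b, fun s hs ω => (hs ω).trans ?_, fun s hs ω => (hs ω).trans ?_⟩
      · exact_mod_cast min_le_left a b
      · exact_mod_cast min_le_right a b)
  refine h.to_hasBasis (fun ε _ => ⟨ε, ε.2, subset_rfl⟩) (fun ε hε => ⟨⟨ε, hε⟩, trivial, subset_rfl⟩)

instance BoundedRV.neBot_uniformApprox (X : BoundedRV Ω) : X.uniformApprox.NeBot := by
  refine X.hasBasis_uniformApprox.neBot_iff.2 fun {ε} hε => ?_
  obtain ⟨C, hC⟩ := X.bounded'
  -- round `X` down to the grid of mesh `ε`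
  have hm : Measurable fun ω => ε * (⌊X.toFun ω / ε⌋ : ℝ) :=
    measurable_const.mul
      ((measurable_from_top (f := fun n : ℤ => (n : ℝ))).comp (X.measurable'.div_const ε).floor)
  have hf : (Set.range fun ω => ε * (⌊X.toFun ω / ε⌋ : ℝ)).Finite := by
    refine ((Set.finite_Icc ⌊-C / ε⌋ ⌊C / ε⌋).image fun n : ℤ => ε * (n : ℝ)).subset ?_
    rintro _ ⟨ω, rfl⟩
    have := abs_le.1 (hC ω)
    refine ⟨⌊X.toFun ω / ε⌋, ⟨Int.floor_le_floor ?_, Int.floor_le_floor ?_⟩, rfl⟩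
    · exact div_le_div_of_nonneg_right this.1 hε.le
    · exact div_le_div_of_nonneg_right this.2 hε.le
  refine ⟨⟨_, fun x => hm (measurableSet_singleton x), hf⟩, fun ω => ?_⟩
  change |X.toFun ω - ε * (⌊X.toFun ω / ε⌋ : ℝ)| ≤ ε
  have h1 := Int.floor_le (X.toFun ω / ε)
  have h2 := (Int.lt_floor_add_one (X.toFun ω / ε)).le
  rw [le_div_iff₀ hε] at h1
  rw [div_le_iff₀ hε] at h2
  rw [abs_le]
  constructor <;> nlinarith

namespace BoundedCharge

theorem empty (μ : BoundedCharge Ω) : μ.toFun ∅ = 0 := by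
  have := μ.add' ∅ ∅ .empty .empty (Set.disjoint_empty _)
  simpa using this

theorem simpleIntegral_sub (μ : BoundedCharge Ω) (s t : SimpleFunc Ω ℝ) :
    μ.simpleIntegral (s - t) = μ.simpleIntegral s - μ.simpleIntegral t := by
  let T : Set Ω → ℝ →L[ℝ] ℝ := fun A => μ.toFun A • ContinuousLinearMap.id ℝ ℝ
  have hT : FinMeasAdditive (0 : Measure Ω) T := by
    intro A B hA hB _ _ hd
    simp only [T, μ.add' A B hA hB hd, add_smul]
  have key : ∀ u : SimpleFunc Ω ℝ, μ.simpleIntegral u = u.setToSimpleFunc T := by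
    intro u
    simp [simpleIntegral, SimpleFunc.setToSimpleFunc, T, mul_comm]
  rw [key, key, key]
  exact SimpleFunc.setToSimpleFunc_sub (μ := 0) T hT (by simp) (by simp)

theorem sum_fiber (μ : BoundedCharge Ω) (s : SimpleFunc Ω ℝ) (F : Finset ℝ) :
    ∑ x ∈ F, μ.toFun (s ⁻¹' {x}) = μ.toFun (s ⁻¹' F) := by
  classical
  induction F using Finset.induction_on with
  | empty => simp [μ.empty]
  | insert a F ha ih =>
    rw [Finset.sum_insert ha, ih, ← μ.add' _ _ (s.measurableSet_preimage _)
      (s.measurableSet_preimage _), ← Set.preimage_union]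
    · rw [Finset.coe_insert, Set.insert_eq]
    · exact Disjoint.preimage _ (by simpa using ha)

theorem abs_simpleIntegral_le (μ : BoundedCharge Ω) {C ε : ℝ}
    (hC : ∀ A, MeasurableSet A → |μ.toFun A| ≤ C) (s : SimpleFunc Ω ℝ)
    (hε : 0 ≤ ε) (hs : ∀ ω, |s ω| ≤ ε) : |μ.simpleIntegral s| ≤ ε * (2 * C) := by
  classical
  have h1 : |μ.simpleIntegral s| ≤ ∑ x ∈ s.range, ε * |μ.toFun (s ⁻¹' {x})| := by
    refine (Finset.abs_sum_le_sum_abs _ _).trans (Finset.sum_le_sum fun x hx => ?_)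
    obtain ⟨ω, rfl⟩ := SimpleFunc.mem_range.1 hx
    rw [abs_mul]
    exact mul_le_mul_of_nonneg_right (hs ω) (abs_nonneg _)
  refine h1.trans ?_
  rw [← Finset.mul_sum]
  refine mul_le_mul_of_nonneg_left ?_ hε
  rw [← Finset.sum_filter_add_sum_filter_not s.range (fun x => 0 ≤ μ.toFun (s ⁻¹' {x})), two_mul]
  refine add_le_add ?_ ?_
  · rw [Finset.sum_congr rfl fun x hx => abs_of_nonneg (Finset.mem_filter.1 hx).2, μ.sum_fiber]
    exact (le_abs_self _).trans (hC _ (s.measurableSet_preimage _))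
  · rw [Finset.sum_congr rfl fun x hx => abs_of_neg (not_le.1 (Finset.mem_filter.1 hx).2),
      Finset.sum_neg_distrib, μ.sum_fiber]
    exact (neg_le_abs _).trans (hC _ (s.measurableSet_preimage _))

/-- The limit in the definition of `𝔼_μ[X]` exists. -/
theorem tendsto_simpleIntegral (μ : BoundedCharge Ω) (X : BoundedRV Ω) :
    Tendsto μ.simpleIntegral X.uniformApprox (𝓝 (μ.expect X)) := by
  apply tendsto_nhds_limUnder
  rw [← cauchy_map_iff_exists_tendsto, Metric.cauchy_iff]
  refine ⟨inferInstance, fun ε hε => ?_⟩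
  obtain ⟨C, hC⟩ := μ.bounded'
  have hC0 : 0 ≤ C := (abs_nonneg _).trans (hC ∅ .empty)
  obtain ⟨δ, hδ, hδε⟩ : ∃ δ : ℝ, 0 < δ ∧ 2 * δ * (2 * C) < ε := by
    refine ⟨ε / (4 * C + 1) / 2, by positivity, ?_⟩
    rw [mul_div_cancel₀ _ two_ne_zero, div_mul_eq_mul_div, div_lt_iff₀ (by positivity)]
    nlinarith
  refine ⟨_, image_mem_map (X.hasBasis_uniformApprox.mem_of_mem hδ), ?_⟩
  rintro _ ⟨s, hs, rfl⟩ _ ⟨t, ht, rfl⟩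
  rw [Real.dist_eq, ← simpleIntegral_sub]
  refine lt_of_le_of_lt (μ.abs_simpleIntegral_le hC _ (by positivity) fun ω => ?_) hδε
  have h1 := abs_le.1 (hs ω)
  have h2 := abs_le.1 (ht ω)
  rw [SimpleFunc.coe_sub, Pi.sub_apply, abs_le]
  constructor <;> linarith

end BoundedCharge

/-- The inclusion of `ca`, the space of signed measures, into `ba`. -/
def MeasureTheory.SignedMeasure.toCharge (μ : SignedMeasure Ω) : BoundedCharge Ω where
  toFun := μ
  not_measurable' _ hA := μ.not_measurable hA
  add' _ _ hA hB hd := μ.of_union hd hA hB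
  bounded' := by
    let j := μ.toJordanDecomposition
    refine ⟨j.posPart.real Set.univ + j.negPart.real Set.univ, fun A hA => ?_⟩
    rw [← μ.toSignedMeasure_toJordanDecomposition, JordanDecomposition.toSignedMeasure,
      Measure.toSignedMeasure_sub_apply hA]
    refine (abs_sub _ _).trans ?_
    rw [abs_of_nonneg measureReal_nonneg, abs_of_nonneg measureReal_nonneg]
    exact add_le_add (measureReal_mono (Set.subset_univ _)) (measureReal_mono (Set.subset_univ _))

/-- A measure is atomless if each measurable set of positive measure has a measurable subset of
strictly smaller positive measure. -/
def IsAtomless (P : Measure Ω) : Prop :=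
  ∀ A, MeasurableSet A → 0 < P A → ∃ B, MeasurableSet B ∧ B ⊆ A ∧ 0 < P B ∧ P B < P A

/-- `X ∼_P Y`: the random variables have the same distribution under `P`. -/
def EquiDistrib (P : Measure Ω) (X Y : BoundedRV Ω) : Prop :=
  P.map X.toFun = P.map Y.toFun

/-- `P`-invariance of a set of bounded random variables. -/
def IsInvariantSet (P : Measure Ω) (D : Set (BoundedRV Ω)) : Prop :=
  ∀ X ∈ D, ∀ Y : BoundedRV Ω, EquiDistrib P X Y → Y ∈ D

/-- `P`-invariance of a functional `φ : D → ℝ`. -/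
def IsInvariantFunctional (P : Measure Ω) {D : Set (BoundedRV Ω)} (φ : D → ℝ) : Prop :=
  ∀ X Y : D, EquiDistrib P X.1 Y.1 → φ X = φ Y

/-- The lower supporting set `𝓛 ⊆ ca`. -/
def lowerSupp {D : Set (BoundedRV Ω)} (φ : D → ℝ) : Set (SignedMeasure Ω) :=
  {μ | ∀ X : D, μ.toCharge.expect X.1 ≤ φ X}

/-- The upper supporting set `𝓤 ⊆ ca`. -/
def upperSupp {D : Set (BoundedRV Ω)} (φ : D → ℝ) : Set (SignedMeasure Ω) :=
  {μ | ∀ X : D, φ X ≤ μ.toCharge.expect X.1}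

/-- The finitely additive lower supporting set `𝓛ᶠ ⊆ ba`. -/
def lowerSuppFin {D : Set (BoundedRV Ω)} (φ : D → ℝ) : Set (BoundedCharge Ω) :=
  {μ | ∀ X : D, μ.expect X.1 ≤ φ X}

/-- The finitely additive upper supporting set `𝓤ᶠ ⊆ ba`. -/
def upperSuppFin {D : Set (BoundedRV Ω)} (φ : D → ℝ) : Set (BoundedCharge Ω) :=
  {μ | ∀ X : D, φ X ≤ μ.expect X.1}

end

/-! The heart is an averaging argument. Take `μ` in `𝓛ᶠ` and `A`, `B` with `P A = P B`. The signed
measure with constant densities `μ(A) / P(A)` on `B` and `μ(Aᶜ) / P(Aᶜ)` on `Bᶜ` lies in `𝓛`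
(`twoStepMeasure_mem_lowerSupp`). Indeed, each `X` in `D` has `n` equidistributed copies whose sum
is, up to a uniform error independent of `n`, `n` times the step function taking the conditional
means of `X` over `B` and `Bᶜ` on `A` and `Aᶜ`. Apply `μ`, use invariance, divide by `n` and let `n`
grow.

The copies (`exists_rearrangement_on`) are `q(fract(U + i / n))`, with `U` uniform on `A` and `q`
the quantile function of `X` conditioned on `B`. As `q` is monotone, their sum oscillates by at most
`2 * C` when `|X| ≤ C`, and its mean is known.

Since `B` is free, an upper bound `ρ` of `𝓛`, even in `ba`, satisfies `μ(A) / P(A) * P(C) ≤ ρ(C)`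
for every measurable `C` and every nonnull `A` (`div_mul_measureReal_le`). Let `a` be the supremum
of these ratios. Then `a • P` lies below all upper bounds of `𝓛`. It also dominates `𝓛ᶠ`, because
members of `𝓛ᶠ` vanish on null sets. As `𝓛 ⊆ 𝓛ᶠ`, it is the supremum of both. Part (ii) follows by
replacing `φ` with `-φ`. -/

noncomputable section

variable {Ω : Type*} [MeasurableSpace Ω]

/-! ### Atomless measures: Sierpiński's theorem and uniform random variables -/

namespace IsAtomless

variable {P : Measure Ω} [IsFiniteMeasure P]

/-- Atomlessness splits `A` into two pieces of positive measure, and one of them has at most half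
the mass. -/
theorem exists_measureReal_le_half (hP : IsAtomless P) {A : Set Ω} (hA : MeasurableSet A)
    (h0 : 0 < P.real A) :
    ∃ B, MeasurableSet B ∧ B ⊆ A ∧ 0 < P.real B ∧ P.real B ≤ P.real A / 2 := by
  obtain ⟨B, hB, hBA, hB0, hlt⟩ := hP A hA (by
    rw [pos_iff_ne_zero]; intro h; simp [measureReal_def, h] at h0)
  have h1 : 0 < P.real B := ENNReal.toReal_pos hB0.ne' (measure_ne_top _ _)
  have h2 : P.real B < P.real A := ENNReal.toReal_strict_mono (measure_ne_top _ _) hlt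
  have h3 : P.real (A \ B) = P.real A - P.real B := measureReal_sdiff hBA hB
  rcases le_total (P.real B) (P.real A / 2) with h | h
  · exact ⟨B, hB, hBA, h1, h⟩
  · exact ⟨A \ B, hA.diff hB, Set.sdiff_subset, by linarith, by linarith⟩

theorem exists_measureReal_le (hP : IsAtomless P) {A : Set Ω} (hA : MeasurableSet A)
    (h0 : 0 < P.real A) {ε : ℝ} (hε : 0 < ε) :
    ∃ B, MeasurableSet B ∧ B ⊆ A ∧ 0 < P.real B ∧ P.real B ≤ ε := by
  have key : ∀ n : ℕ, ∃ B, MeasurableSet B ∧ B ⊆ A ∧ 0 < P.real B ∧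
      P.real B ≤ P.real A * (1 / 2) ^ n := by
    intro n
    induction n with
    | zero => exact ⟨A, hA, subset_rfl, h0, by simp⟩
    | succ n ih =>
      obtain ⟨B, hB, hBA, hB0, hle⟩ := ih
      obtain ⟨C, hC, hCB, hC0, hle'⟩ := hP.exists_measureReal_le_half hB hB0
      refine ⟨C, hC, hCB.trans hBA, hC0, hle'.trans ?_⟩
      rw [pow_succ]
      linarith
  have ht : Tendsto (fun n : ℕ => P.real A * (1 / 2 : ℝ) ^ n) atTop (𝓝 (P.real A * 0)) :=
    (tendsto_pow_atTop_nhds_zero_of_lt_one (by norm_num) (by norm_num)).const_mul _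
  rw [mul_zero] at ht
  obtain ⟨n, hn⟩ := (ht.eventually_lt_const hε).exists
  obtain ⟨B, hB, hBA, hB0, hle⟩ := key n
  exact ⟨B, hB, hBA, hB0, hle.trans hn.le⟩

/-- Sierpiński's theorem: the values of an atomless measure on the subsets of a set fill an
interval. -/
theorem exists_measureReal_eq (hP : IsAtomless P) {A : Set Ω} (hA : MeasurableSet A) {t : ℝ}
    (ht0 : 0 ≤ t) (htA : t ≤ P.real A) : ∃ B, MeasurableSet B ∧ B ⊆ A ∧ P.real B = t := by
  let T := {B : Set Ω // MeasurableSet B ∧ B ⊆ A ∧ P.real B ≤ t}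
  -- Greedy exhaustion: each admissible `B` has an admissible enlargement gaining at least half of
  -- what any enlargement can gain.
  have step : ∀ B : T, ∃ C : T, B.1 ⊆ C.1 ∧
      ∀ E : T, B.1 ⊆ E.1 → P.real E.1 - P.real B.1 ≤ 2 * (P.real C.1 - P.real B.1) := by
    intro B
    let S : Set ℝ := {x | ∃ E : T, B.1 ⊆ E.1 ∧ P.real E.1 = x}
    have hS : BddAbove S := ⟨t, by rintro _ ⟨E, -, rfl⟩; exact E.2.2.2⟩
    have hB : P.real B.1 ≤ sSup S := le_csSup hS ⟨B, subset_rfl, rfl⟩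
    rcases hB.eq_or_lt with h | h
    · refine ⟨B, subset_rfl, fun E hE => ?_⟩
      have := le_csSup hS ⟨E, hE, rfl⟩
      linarith
    · obtain ⟨_, ⟨C, hBC, rfl⟩, hC⟩ := exists_lt_of_lt_csSup
        (show S.Nonempty from ⟨_, B, subset_rfl, rfl⟩)
        (show (P.real B.1 + sSup S) / 2 < sSup S by linarith)
      refine ⟨C, hBC, fun E hE => ?_⟩
      have := le_csSup hS ⟨E, hE, rfl⟩
      linarith
  choose next hsub hnext using step
  let B : ℕ → T := fun n => next^[n] ⟨∅, .empty, Set.empty_subset _, by simpa using ht0⟩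
  have hBs : ∀ n, B (n + 1) = next (B n) := fun n => Function.iterate_succ_apply' _ _ _
  have hmono : Monotone fun n => (B n).1 :=
    monotone_nat_of_le_succ fun n => by rw [hBs]; exact hsub _
  have hlim : Tendsto (fun n => P.real (B n).1) atTop (𝓝 (P.real (⋃ n, (B n).1))) :=
    (ENNReal.tendsto_toReal (measure_ne_top _ _)).comp (tendsto_measure_iUnion_atTop hmono)
  have hUm : MeasurableSet (⋃ n, (B n).1) := .iUnion fun n => (B n).2.1
  have hUA : (⋃ n, (B n).1) ⊆ A := Set.iUnion_subset fun n => (B n).2.2.1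
  have hUt : P.real (⋃ n, (B n).1) ≤ t := le_of_tendsto' hlim fun n => (B n).2.2.2
  refine ⟨_, hUm, hUA, hUt.antisymm (not_lt.1 fun hlt => ?_)⟩
  obtain ⟨C, hC, hCA, hC0, hCle⟩ := hP.exists_measureReal_le (hA.diff hUm)
    (by rw [measureReal_sdiff hUA hUm]; linarith) (sub_pos.2 hlt)
  have hPE : P.real ((⋃ n, (B n).1) ∪ C) = P.real (⋃ n, (B n).1) + P.real C :=
    measureReal_union (Set.disjoint_of_subset_right hCA Set.disjoint_sdiff_right) hC
  -- If the limit falls short of `t`, a small extra piece gives a competitor `E` at every stage. The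
  -- greedy gains tend to `0`, so `E` cannot exceed the limit.
  let E : T := ⟨(⋃ n, (B n).1) ∪ C, hUm.union hC,
    Set.union_subset hUA (hCA.trans Set.sdiff_subset), by linarith⟩
  have h1 : ∀ n, P.real E.1 - P.real (B n).1 ≤ 2 * (P.real (B (n + 1)).1 - P.real (B n).1) := by
    intro n
    rw [hBs]
    exact hnext _ E ((Set.subset_iUnion (fun n => (B n).1) n).trans Set.subset_union_left)
  have h2 := le_of_tendsto_of_tendsto' (hlim.const_sub (P.real E.1))
    (((hlim.comp (tendsto_add_atTop_nat 1)).sub hlim).const_mul 2) h1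
  rw [sub_self, mul_zero] at h2
  change P.real ((⋃ n, (B n).1) ∪ C) - _ ≤ 0 at h2
  linarith

/-- A refining sequence of equipartitions of `A` into `2 ^ n` cells, coded by the cell number. -/
theorem exists_dyadic_partition (hP : IsAtomless P) {A : Set Ω} (hA : MeasurableSet A) :
    ∃ c : ℕ → Ω → ℕ, (∀ n, Measurable (c n)) ∧
      (∀ n ω, c n ω < 2 ^ n) ∧
      (∀ n ω, 2 * c n ω ≤ c (n + 1) ω ∧ c (n + 1) ω ≤ 2 * c n ω + 1) ∧
      ∀ n k, k < 2 ^ n → P.real (A ∩ c n ⁻¹' {k}) = P.real A / 2 ^ n := by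
  classical
  have hhalf : ∀ E : {E : Set Ω // MeasurableSet E}, ∃ B : Set Ω, MeasurableSet B ∧
      B ⊆ E.1 ∧ P.real B = P.real E.1 / 2 := fun E =>
    hP.exists_measureReal_eq E.2 (by positivity) (half_le_self measureReal_nonneg)
  choose half hm hs hh using hhalf
  let T := {f : Ω → ℕ // Measurable f}
  let cell : T → ℕ → {E : Set Ω // MeasurableSet E} := fun f k =>
    ⟨A ∩ f.1 ⁻¹' {k}, hA.inter (f.2 (measurableSet_singleton k))⟩
  let S : T → Set Ω := fun f => ⋃ k, half (cell f k)
  have hSm : ∀ f, MeasurableSet (S f) := fun f => .iUnion fun k => hm _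
  -- Cell `k` splits into cell `2 * k + 1`, the chosen half, and cell `2 * k`, the rest.
  let next : T → T := fun f => ⟨fun ω => 2 * f.1 ω + (S f).indicator 1 ω,
    (f.2.const_mul 2).add (measurable_one.indicator (hSm f))⟩
  let c : ℕ → T := fun n => next^[n] ⟨fun _ => 0, measurable_const⟩
  have hcs : ∀ n, c (n + 1) = next (c n) := fun n => Function.iterate_succ_apply' _ _ _
  have hind : ∀ f : T, ∀ ω, (S f).indicator (1 : Ω → ℕ) ω ≤ 1 := fun f ω =>
    Set.indicator_le_self' (by simp) ω
  have hstep : ∀ n ω, 2 * (c n).1 ω ≤ (c (n + 1)).1 ω ∧ (c (n + 1)).1 ω ≤ 2 * (c n).1 ω + 1 := by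
    intro n ω
    rw [hcs]
    have := hind (c n) ω
    change 2 * (c n).1 ω ≤ 2 * (c n).1 ω + (S (c n)).indicator 1 ω ∧
      2 * (c n).1 ω + (S (c n)).indicator 1 ω ≤ 2 * (c n).1 ω + 1
    omega
  have hmemS : ∀ f : T, ∀ k ω, ω ∈ A → f.1 ω = k → (ω ∈ S f ↔ ω ∈ half (cell f k)) := by
    intro f k ω hω hk
    refine ⟨fun h => ?_, fun h => Set.mem_iUnion.2 ⟨k, h⟩⟩
    obtain ⟨j, hj⟩ := Set.mem_iUnion.1 h
    have : f.1 ω = j := (hs _ hj).2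
    rwa [← hk, this]
  refine ⟨fun n => (c n).1, fun n => (c n).2, ?_, hstep, ?_⟩
  · intro n ω
    induction n with
    | zero => simp [c]
    | succ n ih => 
      have h : (c (n + 1)).1 ω ≤ 2 * (c n).1 ω + 1 := (hstep n ω).2
      have ih : (c n).1 ω < 2 ^ n := ih
      change (c (n + 1)).1 ω < 2 ^ (n + 1)
      rw [pow_succ]
      omega
  · intro n
    induction n with
    | zero =>
      intro k hk
      obtain rfl : k = 0 := by simpa using hk
      simp [c]
    | succ n ih =>
      intro k hk
      have hk2 : k / 2 < 2 ^ n := by rw [pow_succ] at hk; omega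
      have h1 : P.real (half (cell (c n) (k / 2))) = P.real A / 2 ^ (n + 1) := by
        rw [hh]
        change P.real (A ∩ (c n).1 ⁻¹' {k / 2}) / 2 = _
        rw [ih _ hk2, pow_succ, div_div]
      have h2 : P.real ((cell (c n) (k / 2)).1 \ half (cell (c n) (k / 2)))
          = P.real A / 2 ^ (n + 1) := by
        rw [measureReal_sdiff (hs _) (hm _), h1]
        change P.real (A ∩ (c n).1 ⁻¹' {k / 2}) - _ = _
        rw [ih _ hk2, pow_succ]
        ring
      have hval : ∀ ω, (c (n + 1)).1 ω = 2 * (c n).1 ω + (S (c n)).indicator 1 ω := by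
        intro ω; rw [hcs]
      rcases Nat.mod_two_eq_zero_or_one k with hk0 | hk1
      · rw [← h2]
        congr 1
        ext ω
        simp only [Set.mem_inter_iff, Set.mem_preimage, Set.mem_singleton_iff, Set.mem_sdiff,
          hval]
        have hi := hind (c n) ω
        constructor
        · rintro ⟨hω, h⟩
          have hc : (c n).1 ω = k / 2 := by omega
          refine ⟨⟨hω, hc⟩, fun hmem => ?_⟩
          rw [Set.indicator_of_mem ((hmemS _ _ ω hω hc).2 hmem), Pi.one_apply] at h
          omega
        · rintro ⟨⟨hω, hc⟩, hn⟩
          have hc : (c n).1 ω = k / 2 := hc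
          refine ⟨hω, ?_⟩
          rw [Set.indicator_of_notMem (fun h => hn ((hmemS _ _ ω hω hc).1 h))]
          omega
      · rw [← h1]
        congr 1
        ext ω
        simp only [Set.mem_inter_iff, Set.mem_preimage, Set.mem_singleton_iff, hval]
        have hi := hind (c n) ω
        constructor
        · rintro ⟨hω, h⟩
          have hc : (c n).1 ω = k / 2 := by omega
          refine (hmemS _ _ ω hω hc).1 (by_contra fun hn => ?_)
          rw [Set.indicator_of_notMem hn] at h
          omega
        · intro hmem
          have hω := (hs _ hmem).1
          have hc : (c n).1 ω = k / 2 := (hs _ hmem).2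
          refine ⟨hω, ?_⟩
          rw [Set.indicator_of_mem ((hmemS _ _ ω hω hc).2 hmem), Pi.one_apply]
          omega

/-- Every measurable set of an atomless space carries a uniformly distributed random variable. -/
theorem exists_uniform (hP : IsAtomless P) {A : Set Ω} (hA : MeasurableSet A) :
    ∃ U : Ω → ℝ, Measurable U ∧
      (P.restrict A).map U = P A • volume.restrict (Set.Ioc (0 : ℝ) 1) := by
  obtain ⟨c, hcm, hclt, hstep, hcell⟩ := hP.exists_dyadic_partition hA
  have hlo : ∀ ω, Monotone fun n => (c n ω : ℝ) / 2 ^ n := fun ω => by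
    refine monotone_nat_of_le_succ fun n => ?_
    rw [pow_succ, mul_comm, ← div_div]
    refine div_le_div_of_nonneg_right ?_ (by positivity)
    rw [le_div_iff₀ two_pos]
    exact_mod_cast (mul_comm _ _).trans_le (hstep n ω).1
  have hhi : ∀ ω, Antitone fun n => ((c n ω : ℝ) + 1) / 2 ^ n := fun ω => by
    refine antitone_nat_of_succ_le fun n => ?_
    rw [pow_succ, mul_comm, ← div_div]
    refine div_le_div_of_nonneg_right ?_ (by positivity)
    rw [div_le_iff₀ two_pos]
    have : (c (n + 1) ω : ℝ) ≤ 2 * c n ω + 1 := by exact_mod_cast (hstep n ω).2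
    linarith
  have hlh : ∀ ω m n, (c m ω : ℝ) / 2 ^ m ≤ ((c n ω : ℝ) + 1) / 2 ^ n := fun ω m n => by
    refine (hlo ω (le_max_left m n)).trans (le_trans ?_ (hhi ω (le_max_right m n)))
    exact div_le_div_of_nonneg_right (by linarith) (by positivity)
  -- `c n ω` records the first `n` binary digits of `U ω`.
  let U : Ω → ℝ := fun ω => ⨆ n, (c n ω : ℝ) / 2 ^ n
  have hUlo : ∀ ω n, (c n ω : ℝ) / 2 ^ n ≤ U ω := fun ω n =>
    le_ciSup (f := fun n => (c n ω : ℝ) / 2 ^ n) ⟨_, by rintro _ ⟨m, rfl⟩; exact hlh ω m 0⟩ n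
  have hUhi : ∀ ω n, U ω ≤ ((c n ω : ℝ) + 1) / 2 ^ n := fun ω n => ciSup_le fun m => hlh ω m n
  have hUm : Measurable U := .iSup fun n =>
    ((measurable_from_top (f := fun k : ℕ => (k : ℝ))).comp (hcm n)).div_const _
  refine ⟨U, hUm, ?_⟩
  have hlt : ∀ n k, k ≤ 2 ^ n → P.real (A ∩ c n ⁻¹' (Set.Iio k)) = k * (P.real A / 2 ^ n) := by
    intro n k hk
    induction k with
    | zero => simp
    | succ k ih =>
      have : A ∩ c n ⁻¹' Set.Iio (k + 1) = A ∩ c n ⁻¹' Set.Iio k ∪ A ∩ c n ⁻¹' {k} := by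
        rw [← Set.inter_union_distrib_left, ← Set.preimage_union]
        congr 2
        ext j
        simp only [Set.mem_Iio, Set.mem_union, Set.mem_singleton_iff]
        omega
      rw [this, measureReal_union _ (hA.inter (hcm n (measurableSet_singleton k))),
        ih (by omega), hcell n k (by omega)]
      · push_cast; ring
      · refine Set.disjoint_of_subset Set.inter_subset_right Set.inter_subset_right
          (Disjoint.preimage _ ?_)
        simp
  have hU : ∀ t, 0 ≤ t → t < 1 → P.real (A ∩ U ⁻¹' Set.Iic t) = P.real A * t := by
    intro t ht0 ht1
    -- With `k = ⌊t * 2 ^ n⌋₊`, inside `A` the event `U ≤ t` lies between `c n < k` and `c n < k +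
    -- 1`, whose measures differ by one cell.
    have hb : ∀ n : ℕ, |P.real (A ∩ U ⁻¹' Set.Iic t) - P.real A * t| ≤ P.real A / 2 ^ n := by
      intro n
      have h2 : (0 : ℝ) < 2 ^ n := by positivity
      have hk1 : (⌊t * 2 ^ n⌋₊ : ℝ) ≤ t * 2 ^ n := Nat.floor_le (by positivity)
      have hk2 : t * 2 ^ n < (⌊t * 2 ^ n⌋₊ : ℝ) + 1 := Nat.lt_floor_add_one _
      have hk3 : ⌊t * 2 ^ n⌋₊ < 2 ^ n := by
        rw [Nat.floor_lt (by positivity)]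
        push_cast
        nlinarith
      generalize ⌊t * 2 ^ n⌋₊ = k at hk1 hk2 hk3
      have hle : P.real (A ∩ c n ⁻¹' (Set.Iio k)) ≤ P.real (A ∩ U ⁻¹' Set.Iic t) := by
        refine measureReal_mono (Set.inter_subset_inter_right _ fun ω hω => ?_)
        refine (hUhi ω n).trans ?_
        rw [div_le_iff₀ h2]
        have hω : c n ω < k := hω
        have : (c n ω : ℝ) + 1 ≤ k := by exact_mod_cast hω
        linarith
      have hge : P.real (A ∩ U ⁻¹' Set.Iic t) ≤ P.real (A ∩ c n ⁻¹' (Set.Iio (k + 1))) := by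
        refine measureReal_mono (Set.inter_subset_inter_right _ fun ω hω => ?_)
        have h := (hUlo ω n).trans (Set.mem_Iic.1 hω)
        rw [div_le_iff₀ h2] at h
        have : (c n ω : ℝ) < (k + 1 : ℕ) := by push_cast; linarith
        exact_mod_cast this
      rw [hlt n k (by omega)] at hle
      rw [hlt n (k + 1) (by omega)] at hge
      push_cast at hge
      have hq : 0 ≤ P.real A / 2 ^ n := by positivity
      have hA2 : P.real A = P.real A / 2 ^ n * 2 ^ n := by field_simp
      generalize P.real A / 2 ^ n = q at *
      rw [hA2, abs_le]
      constructor <;> nlinarith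
    have hlim : Tendsto (fun n : ℕ => P.real A / (2 : ℝ) ^ n) atTop (𝓝 0) :=
      tendsto_const_nhds.div_atTop (tendsto_pow_atTop_atTop_of_one_lt one_lt_two)
    have := ge_of_tendsto' hlim hb
    exact sub_eq_zero.1 (abs_nonpos_iff.1 this)
  have hU01 : ∀ ω, 0 ≤ U ω ∧ U ω ≤ 1 := fun ω => by
    have h1 := hUlo ω 0
    have h2 := hUhi ω 0
    have : c 0 ω = 0 := by simpa using hclt 0 ω
    simp only [this] at h1 h2
    norm_num at h1 h2
    exact ⟨h1, h2⟩
  have : IsFiniteMeasure (P A • volume.restrict (Set.Ioc (0 : ℝ) 1)) :=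
    Measure.smul_finite _ (measure_ne_top _ _)
  refine Measure.ext_of_Iic _ _ fun t => ?_
  rw [Measure.map_apply hUm measurableSet_Iic, Measure.restrict_apply (hUm measurableSet_Iic),
    Set.inter_comm, Measure.smul_apply, Measure.restrict_apply measurableSet_Iic, smul_eq_mul,
    ← ENNReal.toReal_eq_toReal_iff' (measure_ne_top _ _)
      (ENNReal.mul_ne_top (measure_ne_top _ _) (by
        exact ne_top_of_le_ne_top (by simp) (measure_mono (Set.inter_subset_right)))),
    ENNReal.toReal_mul]
  change P.real _ = P.real A * _
  rcases lt_or_ge t 0 with h | h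
  · have h1 : U ⁻¹' Set.Iic t = ∅ := by
      ext ω; simpa using h.trans_le (hU01 ω).1
    have h2 : Set.Iic t ∩ Set.Ioc (0 : ℝ) 1 = ∅ := by
      ext x; simp only [Set.mem_inter_iff, Set.mem_Iic, Set.mem_Ioc, Set.mem_empty_iff_false,
        iff_false]
      intro hx; linarith [hx.1, hx.2.1]
    simp [h1, h2]
  rcases lt_or_ge t 1 with h' | h'
  · have h2 : Set.Iic t ∩ Set.Ioc (0 : ℝ) 1 = Set.Ioc 0 t := by
      ext x; simp only [Set.mem_inter_iff, Set.mem_Iic, Set.mem_Ioc]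
      constructor
      · intro hx; exact ⟨hx.2.1, hx.1⟩
      · intro hx; exact ⟨hx.2, hx.1, hx.2.trans h'.le⟩
    rw [hU t h h', h2, Real.volume_Ioc, sub_zero, ENNReal.toReal_ofReal h]
  · have h1 : U ⁻¹' Set.Iic t = Set.univ := by
      ext ω; simpa using (hU01 ω).2.trans h'
    have h2 : Set.Iic t ∩ Set.Ioc (0 : ℝ) 1 = Set.Ioc 0 1 := by
      rw [Set.inter_eq_right]; exact fun x hx => hx.2.trans h'
    rw [h1, h2]
    simp

end IsAtomless

/-! ### Quantile functions and rotations of the unit interval -/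

/-- A probability measure on a bounded interval is the image of Lebesgue measure on `(0, 1]` under
its quantile function. -/
theorem exists_monotone_map_eq (ν : Measure ℝ) [IsProbabilityMeasure ν] {C : ℝ} (hC0 : 0 ≤ C)
    (hC : ∀ᵐ x ∂ν, |x| ≤ C) :
    ∃ q : ℝ → ℝ, Monotone q ∧ (∀ t, |q t| ≤ C) ∧
      (volume.restrict (Set.Ioc (0 : ℝ) 1)).map q = ν := by
  let F := ProbabilityTheory.cdf ν
  have hF : ∀ x, F x = ν.real (Set.Iic x) := ProbabilityTheory.cdf_eq_real ν
  have hFC : ∀ x, C ≤ x → F x = 1 := fun x hx => by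
    rw [hF, measureReal_def, (prob_compl_eq_zero_iff measurableSet_Iic).1, ENNReal.toReal_one]
    refine measure_mono_null (fun y hy => ?_) hC
    intro h
    exact hy ((le_abs_self y).trans (h.trans hx))
  have hFC' : ∀ x, x < -C → F x = 0 := fun x hx => by
    rw [hF, measureReal_def, measure_mono_null (fun y hy => ?_) hC, ENNReal.toReal_zero]
    intro h
    have := (abs_le.1 (show |y| ≤ C from h)).1
    have hy : y ≤ x := hy
    linarith
  -- The bound `-C ≤ x` and the truncation `min t 1` keep the infimum meaningful for `t` outside
  -- `(0, 1]`, so that `q` is monotone and bounded on the whole line.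
  let S : ℝ → Set ℝ := fun t => {x | -C ≤ x ∧ min t 1 ≤ F x}
  have hSC : ∀ t, C ∈ S t := fun t => ⟨by linarith, by rw [hFC C le_rfl]; exact min_le_right _ _⟩
  have hSb : ∀ t, BddBelow (S t) := fun t => ⟨-C, fun x hx => hx.1⟩
  let q : ℝ → ℝ := fun t => sInf (S t)
  have hq : Monotone q := fun s t hst => csInf_le_csInf (hSb s) ⟨C, hSC t⟩ fun x hx =>
    ⟨hx.1, (min_le_min_right _ hst).trans hx.2⟩
  have hqC : ∀ t, |q t| ≤ C := fun t => abs_le.2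
    ⟨le_csInf ⟨C, hSC t⟩ fun x hx => hx.1, csInf_le (hSb t) (hSC t)⟩
  -- The Galois connection between quantile and distribution function; one direction needs right
  -- continuity of `F`.
  have hqF : ∀ t, 0 < t → t ≤ 1 → ∀ x, q t ≤ x ↔ t ≤ F x := by
    intro t ht0 ht1 x
    constructor
    · intro h
      have hgt : ∀ y, x < y → t ≤ F y := fun y hy => by
        obtain ⟨z, hz, hzy⟩ := exists_lt_of_csInf_lt ⟨C, hSC t⟩ (h.trans_lt hy)
        have := hz.2
        rw [min_eq_left ht1] at this
        exact this.trans (F.mono hzy.le)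
      have hc : Tendsto F (𝓝[>] x) (𝓝 (F x)) :=
        (F.right_continuous x).tendsto.mono_left (nhdsWithin_mono _ Set.Ioi_subset_Ici_self)
      exact ge_of_tendsto hc (eventually_nhdsWithin_of_forall hgt)
    · intro h
      refine csInf_le (hSb t) ⟨not_lt.1 fun hx => ?_, by rwa [min_eq_left ht1]⟩
      rw [hFC' x hx] at h
      linarith
  refine ⟨q, hq, hqC, Measure.ext_of_Iic _ _ fun x => ?_⟩
  rw [Measure.map_apply hq.measurable measurableSet_Iic,
    Measure.restrict_apply (hq.measurable measurableSet_Iic)]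
  have hset : q ⁻¹' Set.Iic x ∩ Set.Ioc 0 1 = Set.Ioc 0 (F x) := by
    ext t
    simp only [Set.mem_inter_iff, Set.mem_preimage, Set.mem_Iic, Set.mem_Ioc]
    constructor
    · rintro ⟨h, h0, h1⟩
      exact ⟨h0, (hqF t h0 h1 x).1 h⟩
    · rintro ⟨h0, h⟩
      have h1 := h.trans (ProbabilityTheory.cdf_le_one ν x)
      exact ⟨(hqF t h0 h1 x).2 h, h0, h1⟩
  rw [hset, Real.volume_Ioc, sub_zero, hF, ofReal_measureReal]

/-- Translation modulo `1` preserves Lebesgue measure on `(0, 1]`. -/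
theorem map_fract_add {g : ℝ → ℝ} (hg : Measurable g) (s : ℝ) :
    (volume.restrict (Set.Ioc (0 : ℝ) 1)).map (fun x => g (Int.fract (x + s))) =
      (volume.restrict (Set.Ioc (0 : ℝ) 1)).map g := by
  have hgf : Measurable fun x => g (Int.fract x) := hg.comp measurable_fract
  ext S hS
  have hgs : Measurable fun x => g (Int.fract (x + s)) := hgf.comp (measurable_add_const s)
  rw [Measure.map_apply hgs hS, Measure.map_apply hg hS, Measure.restrict_apply (hgs hS),
    Measure.restrict_apply (hg hS)]
  let E := (fun x => g (Int.fract x)) ⁻¹' S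
  have hE : MeasurableSet E := hgf hS
  have h1 : (fun x => g (Int.fract (x + s))) ⁻¹' S ∩ Set.Ioc 0 1 =
      (fun x => x + s) ⁻¹' (E ∩ Set.Ioc s (s + 1)) := by
    ext x
    simp only [E, Set.mem_inter_iff, Set.mem_preimage, Set.mem_Ioc]
    refine and_congr_right fun _ => and_congr ?_ ?_ <;> constructor <;> intro <;> linarith
  -- `E` is invariant under integer translations, and both intervals are fundamental domains for
  -- them.
  have h2 : volume (E ∩ Set.Ioc s (s + 1)) = volume (E ∩ Set.Ioc 0 (0 + 1)) := by
    refine (isAddFundamentalDomain_Ioc one_pos s volume).measure_set_eq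
      (isAddFundamentalDomain_Ioc one_pos 0 volume) hE ?_
    rintro ⟨_, k, rfl⟩
    ext x
    change g (Int.fract (k • (1 : ℝ) + x)) ∈ S ↔ g (Int.fract x) ∈ S
    rw [zsmul_one, Int.fract_intCast_add]
  rw [h1, measure_preimage_add_right, h2, zero_add]
  refine measure_congr ?_
  have : ∀ᵐ x : ℝ, x ≠ 1 := by simp [ae_iff]
  filter_upwards [this] with x hx
  refine propext (and_congr_left fun hx' => ?_)
  have hx' : 0 < x ∧ x ≤ 1 := hx'
  change g (Int.fract x) ∈ S ↔ g x ∈ S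
  rw [Int.fract_eq_self.2 ⟨hx'.1.le, lt_of_le_of_ne hx'.2 hx⟩]

/-- The sums of a monotone function over the translates of an equidistant grid modulo `1` have
oscillation bounded independently of the mesh. -/
theorem abs_sum_fract_sub_le {q : ℝ → ℝ} (hq : Monotone q) {C : ℝ} (hC : ∀ t, |q t| ≤ C)
    {n : ℕ} (hn : 0 < n) (u v : ℝ) :
    |∑ i ∈ Finset.range n, q (Int.fract (u + i / n)) -
      ∑ i ∈ Finset.range n, q (Int.fract (v + i / n))| ≤ 2 * C := by
  have hn' : (0 : ℝ) < n := by exact_mod_cast hn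
  let F : ℝ → ℝ := fun u => ∑ i ∈ Finset.range n, q (Int.fract (u + i / n))
  -- A shift by `1 / n` permutes the grid modulo `1` cyclically: the sum over `n + 1` points can
  -- lose its first or its last term, and these two terms agree.
  have hper : Function.Periodic F (1 / n) := fun u => by
    have h := (Finset.sum_range_succ' (fun i : ℕ => q (Int.fract (u + i / n))) n).symm.trans
      (Finset.sum_range_succ _ n)
    rw [div_self hn'.ne', Int.fract_add_one] at h
    simp only [Nat.cast_zero, zero_div, add_zero, add_left_inj] at h
    rw [← show _ = F u from h]
    refine Finset.sum_congr rfl fun i _ => ?_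
    congr 2
    push_cast
    ring
  have hfr : ∀ u ∈ Set.Ico (0 : ℝ) (1 / n), ∀ i < n, Int.fract (u + i / n) = u + i / n := by
    intro u hu i hi
    refine Int.fract_eq_self.2 ⟨add_nonneg hu.1 (by positivity), ?_⟩
    have h1 : (i : ℝ) + 1 ≤ n := by exact_mod_cast hi
    have h2 : ((i : ℝ) + 1) / n ≤ 1 := (div_le_one hn').2 h1
    rw [add_div] at h2
    linarith [hu.2]
  have hle : ∀ u ∈ Set.Ico (0 : ℝ) (1 / n), ∀ v ∈ Set.Ico (0 : ℝ) (1 / n), F u - F v ≤ 2 * C := by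
    intro u hu v hv
    have hu' : F u = ∑ i ∈ Finset.range n, q (u + i / n) :=
      Finset.sum_congr rfl fun i hi => by rw [hfr u hu i (Finset.mem_range.1 hi)]
    have hv' : F v = ∑ i ∈ Finset.range n, q (v + i / n) :=
      Finset.sum_congr rfl fun i hi => by rw [hfr v hv i (Finset.mem_range.1 hi)]
    obtain ⟨m, hm⟩ := Nat.exists_eq_succ_of_ne_zero hn.ne'
    -- The two grids interlace, so by monotonicity the difference reduces to the last term at `u`
    -- minus the first term at `v`.
    have hs : ∑ i ∈ Finset.range m, q (u + i / n) ≤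
        ∑ i ∈ Finset.range m, q (v + (i + 1 : ℕ) / n) := by
      refine Finset.sum_le_sum fun i _ => hq ?_
      push_cast
      rw [add_div]
      linarith [hu.2, hv.1]
    have hr : Finset.range n = Finset.range (m + 1) := by rw [hm]
    rw [hu', hv', hr, Finset.sum_range_succ, Finset.sum_range_succ']
    have h1 := (abs_le.1 (hC (u + m / n))).2
    have h2 := (abs_le.1 (hC (v + (0 : ℕ) / n))).1
    linarith
  obtain ⟨u', hu', hFu⟩ := hper.exists_mem_Ico₀ (by positivity) u
  obtain ⟨v', hv', hFv⟩ := hper.exists_mem_Ico₀ (by positivity) v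
  change |F u - F v| ≤ 2 * C
  rw [hFu, hFv, abs_le]
  exact ⟨by linarith [hle v' hv' u' hu'], hle u' hu' v' hv'⟩

/-! ### Rearrangements that approximate conditional means -/

namespace IsAtomless

variable {P : Measure Ω} [IsFiniteMeasure P]

/-- On a set of the same measure as `B` there are `n` copies of `X` restricted to `B` whose
average is within `2 * C / n` of the mean of `X` on `B`. -/
theorem exists_rearrangement_on (hP : IsAtomless P) {A B : Set Ω} (hA : MeasurableSet A)
    (hAB : P A = P B) {X : Ω → ℝ} (hX : Measurable X) {C : ℝ} (hC0 : 0 ≤ C)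
    (hC : ∀ ω, |X ω| ≤ C) {n : ℕ} (hn : 0 < n) :
    ∃ Y : ℕ → Ω → ℝ, (∀ i, Measurable (Y i)) ∧ (∀ i ω, |Y i ω| ≤ C) ∧
      (∀ i, (P.restrict A).map (Y i) = (P.restrict B).map X) ∧
      ∀ ω, |∑ i ∈ Finset.range n, Y i ω - n * ((∫ ω in B, X ω ∂P) / P.real B)| ≤ 2 * C := by
  rcases eq_or_ne (P B) 0 with hB0 | hB0
  · refine ⟨fun _ _ => 0, fun _ => measurable_const, fun _ _ => by simpa using hC0, fun i => ?_, fun ω => ?_⟩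
    · rw [Measure.restrict_eq_zero.2 hB0, Measure.restrict_eq_zero.2 (hAB.trans hB0)]
      simp
    · simp [Measure.restrict_eq_zero.2 hB0, hC0]
  obtain ⟨U, hU, hUlaw⟩ := hP.exists_uniform hA
  have hBt : P B ≠ ⊤ := measure_ne_top _ _
  let ν : Measure ℝ := (P B)⁻¹ • (P.restrict B).map X
  have hν : IsProbabilityMeasure ν := ⟨by
    simp only [ν, Measure.smul_apply, smul_eq_mul]
    rw [Measure.map_apply hX .univ, Set.preimage_univ, Measure.restrict_apply_univ,
      ENNReal.inv_mul_cancel hB0 hBt]⟩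
  obtain ⟨q, hq, hqC, hqν⟩ := exists_monotone_map_eq ν hC0 (by
    refine Measure.ae_smul_measure ?_ _
    rw [ae_map_iff hX.aemeasurable (measurableSet_le measurable_abs measurable_const)]
    exact .of_forall hC)
  -- Rotating the uniform variable by `i / n` keeps its law, so every `f i ∘ U` has on `A` the law
  -- of `X` on `B`.
  let f : ℕ → ℝ → ℝ := fun i u => q (Int.fract (u + i / n))
  have hf : ∀ i, Measurable (f i) := fun i =>
    hq.measurable.comp (measurable_fract.comp (measurable_add_const _))
  let Y : ℕ → Ω → ℝ := fun i ω => f i (U ω)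
  have hY : ∀ i, Measurable (Y i) := fun i => (hf i).comp hU
  have hYC : ∀ i ω, |Y i ω| ≤ C := fun i ω => hqC _
  have hlaw : ∀ i, (P.restrict A).map (Y i) = (P.restrict B).map X := fun i => by
    rw [show Y i = f i ∘ U from rfl, ← Measure.map_map (hf i) hU, hUlaw, Measure.map_smul,
      map_fract_add hq.measurable, hqν, hAB, smul_smul, ENNReal.mul_inv_cancel hB0 hBt, one_smul]
  refine ⟨Y, hY, hYC, hlaw, fun ω => ?_⟩
  have hint : ∀ i, ∫ ω in A, Y i ω ∂P = ∫ ω in B, X ω ∂P := fun i => by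
    have h1 := integral_map (μ := P.restrict A) (hY i).aemeasurable
      (f := fun x : ℝ => x) aestronglyMeasurable_id
    have h2 := integral_map (μ := P.restrict B) hX.aemeasurable
      (f := fun x : ℝ => x) aestronglyMeasurable_id
    rw [← h1, ← h2, hlaw]
  have hYi : ∀ i, Integrable (Y i) (P.restrict A) := fun i =>
    Integrable.of_bound (hY i).aestronglyMeasurable C (.of_forall fun ω => hYC i ω)
  -- Averaging the oscillation bound over `ω'` in `A` turns it into a bound on the distance of the
  -- sum from its mean.
  have hsum : ∫ ω' in A, (∑ i ∈ Finset.range n, Y i ω - ∑ i ∈ Finset.range n, Y i ω') ∂P =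
      P.real B * ∑ i ∈ Finset.range n, Y i ω - n * ∫ ω in B, X ω ∂P := by
    rw [integral_sub (integrable_const _) (integrable_finsetSum _ fun i _ => hYi i),
      integral_finsetSum _ fun i _ => hYi i, Finset.sum_congr rfl fun i _ => hint i]
    simp [measureReal_def, hAB]
  have hbd := norm_setIntegral_le_of_norm_le_const (μ := P) (s := A) (C := 2 * C)
    (f := fun ω' => ∑ i ∈ Finset.range n, Y i ω - ∑ i ∈ Finset.range n, Y i ω')
    (measure_lt_top _ _) fun ω' _ => abs_sum_fract_sub_le hq hqC hn (U ω) (U ω')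
  rw [hsum, Real.norm_eq_abs, show P.real A = P.real B by rw [measureReal_def, hAB]; rfl] at hbd
  have hB : 0 < P.real B := ENNReal.toReal_pos hB0 hBt
  have hscale : (∑ i ∈ Finset.range n, Y i ω - n * ((∫ ω in B, X ω ∂P) / P.real B)) * P.real B =
      P.real B * ∑ i ∈ Finset.range n, Y i ω - n * ∫ ω in B, X ω ∂P := by
    field_simp
  refine le_of_mul_le_mul_right (hbd.trans_eq' ?_) hB
  rw [← hscale, abs_mul, abs_of_pos hB]

/-- There are `n` copies of `X` whose average is `O(1 / n)`-close to the function that takes on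
`A` the mean value of `X` on `B`, and on `Aᶜ` the mean value of `X` on `Bᶜ`. -/
theorem exists_rearrangement (hP : IsAtomless P) {A B : Set Ω} (hA : MeasurableSet A)
    (hB : MeasurableSet B) (hAB : P A = P B) (X : BoundedRV Ω) :
    ∃ K : ℝ, ∀ n : ℕ, 0 < n → ∃ Y : ℕ → BoundedRV Ω, (∀ i, EquiDistrib P X (Y i)) ∧
      (∀ ω ∈ A, |∑ i ∈ Finset.range n, (Y i).toFun ω -
        n * ((∫ ω in B, X.toFun ω ∂P) / P.real B)| ≤ K) ∧
      ∀ ω ∈ Aᶜ, |∑ i ∈ Finset.range n, (Y i).toFun ω -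
        n * ((∫ ω in Bᶜ, X.toFun ω ∂P) / P.real Bᶜ)| ≤ K := by
  classical
  obtain ⟨C, hC⟩ := X.bounded'
  have hC' : ∀ ω, |X.toFun ω| ≤ |C| := fun ω => (hC ω).trans (le_abs_self C)
  have hABc : P Aᶜ = P Bᶜ := by
    rw [measure_compl hA (measure_ne_top _ _), measure_compl hB (measure_ne_top _ _), hAB]
  refine ⟨2 * |C|, fun n hn => ?_⟩
  obtain ⟨Y, hY, hYC, hYl, hYs⟩ :=
    hP.exists_rearrangement_on hA hAB X.measurable' (abs_nonneg C) hC' hn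
  obtain ⟨Z, hZ, hZC, hZl, hZs⟩ :=
    hP.exists_rearrangement_on hA.compl hABc X.measurable' (abs_nonneg C) hC' hn
  have hm : ∀ i, Measurable (A.piecewise (Y i) (Z i)) := fun i => (hY i).piecewise hA (hZ i)
  refine ⟨fun i => ⟨A.piecewise (Y i) (Z i), hm i, |C|, fun ω => ?_⟩, fun i => ?_, ?_, ?_⟩
  · by_cases h : ω ∈ A
    · rw [Set.piecewise_eq_of_mem _ _ _ h]; exact hYC i ω
    · rw [Set.piecewise_eq_of_notMem _ _ _ h]; exact hZC i ω
  · change P.map X.toFun = P.map (A.piecewise (Y i) (Z i))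
    conv_lhs => rw [← Measure.restrict_add_restrict_compl (μ := P) hB]
    conv_rhs => rw [← Measure.restrict_add_restrict_compl (μ := P) hA]
    rw [Measure.map_add _ _ X.measurable', Measure.map_add _ _ (hm i), ← hYl i, ← hZl i]
    congr 1
    · exact Measure.map_congr (piecewise_ae_eq_restrict hA).symm
    · exact Measure.map_congr (piecewise_ae_eq_restrict_compl hA).symm
  · intro ω hω
    simpa [Set.piecewise_eq_of_mem _ _ _ hω] using hYs ω
  · intro ω hω
    simpa [Set.piecewise_eq_of_notMem _ _ _ hω] using hZs ω

end IsAtomless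

/-! ### The integral with respect to a charge -/

namespace BoundedRV

/-- The sum of the first `n` terms of a sequence of bounded random variables. -/
def sumRange (Y : ℕ → BoundedRV Ω) (n : ℕ) : BoundedRV Ω where
  toFun ω := ∑ i ∈ Finset.range n, (Y i).toFun ω
  measurable' := Finset.measurable_fun_sum _ fun i _ => (Y i).measurable'
  bounded' := by
    choose C hC using fun i => (Y i).bounded'
    exact ⟨∑ i ∈ Finset.range n, C i, fun ω =>
      (Finset.abs_sum_le_sum_abs _ _).trans (Finset.sum_le_sum fun i _ => hC i ω)⟩

/-- A simple random variable. -/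
def ofSimple (s : SimpleFunc Ω ℝ) : BoundedRV Ω where
  toFun := s
  measurable' := s.measurable
  bounded' := s.exists_forall_norm_le

open Classical in
/-- The random variable with the value `x` on `A` and `y` on `Aᶜ`. -/
def step {A : Set Ω} (hA : MeasurableSet A) (x y : ℝ) : BoundedRV Ω :=
  ofSimple (SimpleFunc.piecewise A hA (.const Ω x) (.const Ω 0) +
    SimpleFunc.piecewise Aᶜ hA.compl (.const Ω y) (.const Ω 0))

theorem step_of_mem {A : Set Ω} (hA : MeasurableSet A) (x y : ℝ) {ω : Ω} (hω : ω ∈ A) :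
    (step hA x y).toFun ω = x := by
  simp [step, ofSimple, hω]

theorem step_of_notMem {A : Set Ω} (hA : MeasurableSet A) (x y : ℝ) {ω : Ω} (hω : ω ∉ A) :
    (step hA x y).toFun ω = y := by
  simp [step, ofSimple, hω]

end BoundedRV

namespace BoundedCharge

/-- A charge as an operator-valued set function. -/
def toCLM (μ : BoundedCharge Ω) (A : Set Ω) : ℝ →L[ℝ] ℝ :=
  μ.toFun A • ContinuousLinearMap.id ℝ ℝ

/-- The reference measure only restricts additivity to sets of finite measure. With `0` nothing is
excluded and every simple function is integrable. -/
theorem finMeasAdditive_toCLM (μ : BoundedCharge Ω) :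
    FinMeasAdditive (0 : Measure Ω) μ.toCLM := by
  intro A B hA hB _ _ hd
  simp only [toCLM, μ.add' A B hA hB hd, add_smul]

theorem simpleIntegral_eq_setToSimpleFunc (μ : BoundedCharge Ω) (s : SimpleFunc Ω ℝ) :
    μ.simpleIntegral s = s.setToSimpleFunc μ.toCLM := by
  simp [simpleIntegral, SimpleFunc.setToSimpleFunc, toCLM, mul_comm]

theorem simpleIntegral_add (μ : BoundedCharge Ω) (s t : SimpleFunc Ω ℝ) :
    μ.simpleIntegral (s + t) = μ.simpleIntegral s + μ.simpleIntegral t := by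
  simp_rw [simpleIntegral_eq_setToSimpleFunc]
  exact SimpleFunc.setToSimpleFunc_add (μ := 0) _ μ.finMeasAdditive_toCLM (by simp) (by simp)

open Classical in
theorem simpleIntegral_indicator (μ : BoundedCharge Ω) {A : Set Ω} (hA : MeasurableSet A) (x : ℝ) :
    μ.simpleIntegral (SimpleFunc.piecewise A hA (.const Ω x) (.const Ω 0)) = x * μ.toFun A := by
  rw [simpleIntegral_eq_setToSimpleFunc, SimpleFunc.setToSimpleFunc_indicator]
  · simp [toCLM, mul_comm]
  · simp [toCLM, μ.empty]

/-- The constant approximation by `s` itself is admissible, and limits are unique. -/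
theorem expect_ofSimple (μ : BoundedCharge Ω) (s : SimpleFunc Ω ℝ) :
    μ.expect (.ofSimple s) = μ.simpleIntegral s := by
  have h : pure s ≤ (BoundedRV.ofSimple s).uniformApprox := by
    rw [(BoundedRV.hasBasis_uniformApprox _).ge_iff]
    intro ε hε
    simp [BoundedRV.ofSimple, hε.le]
  exact tendsto_nhds_unique ((μ.tendsto_simpleIntegral _).mono_left h) (tendsto_pure_nhds _ s)

theorem expect_step (μ : BoundedCharge Ω) {A : Set Ω} (hA : MeasurableSet A) (x y : ℝ) :
    μ.expect (.step hA x y) = x * μ.toFun A + y * μ.toFun Aᶜ := by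
  rw [BoundedRV.step, expect_ofSimple, simpleIntegral_add, simpleIntegral_indicator,
    simpleIntegral_indicator]

theorem expect_add (μ : BoundedCharge Ω) {X Y Z : BoundedRV Ω}
    (hZ : ∀ ω, Z.toFun ω = X.toFun ω + Y.toFun ω) :
    μ.expect Z = μ.expect X + μ.expect Y := by
  have hX := (μ.tendsto_simpleIntegral X).comp (tendsto_fst (g := Y.uniformApprox))
  have hY := (μ.tendsto_simpleIntegral Y).comp (tendsto_snd (f := X.uniformApprox))
  have h : Tendsto (fun p : SimpleFunc Ω ℝ × SimpleFunc Ω ℝ => p.1 + p.2)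
      (X.uniformApprox ×ˢ Y.uniformApprox) Z.uniformApprox := by
    rw [(X.hasBasis_uniformApprox.prod Y.hasBasis_uniformApprox).tendsto_iff
      Z.hasBasis_uniformApprox]
    intro ε hε
    refine ⟨(ε / 2, ε / 2), ⟨half_pos hε, half_pos hε⟩, ?_⟩
    rintro ⟨s, t⟩ ⟨hs, ht⟩ ω
    have h1 := abs_le.1 (show |X.toFun ω - s ω| ≤ ε / 2 from hs ω)
    have h2 := abs_le.1 (show |Y.toFun ω - t ω| ≤ ε / 2 from ht ω)
    rw [hZ, SimpleFunc.coe_add, Pi.add_apply, abs_le]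
    constructor <;> linarith
  refine tendsto_nhds_unique ((μ.tendsto_simpleIntegral Z).comp h) ((hX.add hY).congr fun p => ?_)
  exact (μ.simpleIntegral_add _ _).symm

theorem expect_sumRange (μ : BoundedCharge Ω) (Y : ℕ → BoundedRV Ω) (n : ℕ) :
    μ.expect (.sumRange Y n) = ∑ i ∈ Finset.range n, μ.expect (Y i) := by
  induction n with
  | zero =>
    have := μ.expect_add (X := .sumRange Y 0) (Y := .sumRange Y 0) (Z := .sumRange Y 0)
      (by simp [BoundedRV.sumRange])
    simpa using this
  | succ n ih =>
    rw [Finset.sum_range_succ, ← ih]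
    exact μ.expect_add fun ω => Finset.sum_range_succ _ _

/-- The integral is Lipschitz continuous for uniform convergence. -/
theorem exists_abs_expect_sub_le (μ : BoundedCharge Ω) :
    ∃ K : ℝ, 0 ≤ K ∧ ∀ (X Y : BoundedRV Ω) (ε : ℝ), 0 ≤ ε →
      (∀ ω, |X.toFun ω - Y.toFun ω| ≤ ε) → |μ.expect X - μ.expect Y| ≤ ε * K := by
  obtain ⟨C, hC⟩ := μ.bounded'
  have hC0 : 0 ≤ C := (abs_nonneg _).trans (hC ∅ .empty)
  refine ⟨2 * C, by positivity, fun X Y ε hε hXY => ?_⟩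
  have hX := (μ.tendsto_simpleIntegral X).comp (tendsto_fst (g := Y.uniformApprox))
  have hY := (μ.tendsto_simpleIntegral Y).comp (tendsto_snd (f := X.uniformApprox))
  have key : ∀ δ : ℝ, 0 < δ → |μ.expect X - μ.expect Y| ≤ (ε + 2 * δ) * (2 * C) := fun δ hδ => by
    refine le_of_tendsto (hX.sub hY).abs ?_
    filter_upwards [(X.hasBasis_uniformApprox.prod Y.hasBasis_uniformApprox).mem_of_mem
      (i := (δ, δ)) ⟨hδ, hδ⟩]
    rintro ⟨s, t⟩ ⟨hs, ht⟩
    simp only [Function.comp_apply]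
    rw [← simpleIntegral_sub]
    refine μ.abs_simpleIntegral_le hC _ (by positivity) fun ω => ?_
    have h1 := abs_le.1 (show |X.toFun ω - s ω| ≤ δ from hs ω)
    have h2 := abs_le.1 (show |Y.toFun ω - t ω| ≤ δ from ht ω)
    have h3 := abs_le.1 (hXY ω)
    rw [SimpleFunc.coe_sub, Pi.sub_apply, abs_le]
    constructor <;> linarith
  have hlim : Tendsto (fun δ : ℝ => (ε + 2 * δ) * (2 * C)) (𝓝[>] 0) (𝓝 (ε * (2 * C))) := by
    have : Continuous fun δ : ℝ => (ε + 2 * δ) * (2 * C) := by fun_prop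
    simpa using (this.tendsto 0).mono_left nhdsWithin_le_nhds
  exact ge_of_tendsto hlim (eventually_nhdsWithin_of_forall key)

theorem expect_eq_of_forall_eq {ρ μ ν : BoundedCharge Ω} {r s : ℝ}
    (h : ∀ A, MeasurableSet A → ρ.toFun A = r * μ.toFun A + s * ν.toFun A) (X : BoundedRV Ω) :
    ρ.expect X = r * μ.expect X + s * ν.expect X := by
  refine tendsto_nhds_unique (ρ.tendsto_simpleIntegral X)
    ((((μ.tendsto_simpleIntegral X).const_mul r).add
      ((ν.tendsto_simpleIntegral X).const_mul s)).congr fun f => ?_)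
  simp only [simpleIntegral, Finset.mul_sum, ← Finset.sum_add_distrib]
  refine Finset.sum_congr rfl fun x _ => ?_
  rw [h _ (f.measurableSet_preimage _)]
  ring

theorem expect_toSignedMeasure (m : Measure Ω) [IsFiniteMeasure m] (X : BoundedRV Ω) :
    m.toSignedMeasure.toCharge.expect X = ∫ ω, X.toFun ω ∂m := by
  refine tendsto_nhds_unique (m.toSignedMeasure.toCharge.tendsto_simpleIntegral X) ?_
  rw [X.hasBasis_uniformApprox.tendsto_iff Metric.nhds_basis_closedBall]
  intro ε hε
  -- The `+ 1` covers the zero measure.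
  refine ⟨ε / (m.real Set.univ + 1), by positivity, fun s hs => ?_⟩
  obtain ⟨C, hC⟩ := X.bounded'
  have hX : Integrable X.toFun m :=
    Integrable.of_bound X.measurable'.aestronglyMeasurable C (.of_forall hC)
  have hs' : Integrable s m := SimpleFunc.integrable_of_isFiniteMeasure s
  have h1 : m.toSignedMeasure.toCharge.simpleIntegral s = ∫ ω, s ω ∂m := by
    rw [← SimpleFunc.integral_eq_integral _ hs', SimpleFunc.integral_eq, simpleIntegral]
    refine Finset.sum_congr rfl fun x _ => ?_
    rw [smul_eq_mul, mul_comm]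
    congr 1
    exact Measure.toSignedMeasure_apply_measurable (s.measurableSet_preimage _)
  rw [Metric.mem_closedBall, dist_comm, Real.dist_eq, h1, ← integral_sub hX hs', ← Real.norm_eq_abs]
  have hs'' : ∀ ω, ‖X.toFun ω - s ω‖ ≤ ε / (m.real Set.univ + 1) := hs
  refine (norm_integral_le_of_norm_le_const (.of_forall hs'')).trans ?_
  rw [div_mul_eq_mul_div, div_le_iff₀ (by positivity)]
  nlinarith

end BoundedCharge

/-! ### Signed measures as charges, and two-step densities -/

theorem MeasureTheory.SignedMeasure.toCharge_le_toCharge {μ ν : SignedMeasure Ω} :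
    μ.toCharge ≤ ν.toCharge ↔ μ ≤ ν := Iff.rfl

theorem toCharge_smul_toSignedMeasure_apply (P : Measure Ω) [IsFiniteMeasure P] (a : ℝ)
    {A : Set Ω} (hA : MeasurableSet A) :
    (a • P.toSignedMeasure).toCharge.toFun A = a * P.real A := by
  change (a • P.toSignedMeasure) A = _
  rw [smul_apply, Measure.toSignedMeasure_apply_measurable hA, smul_eq_mul]

/-- The signed measure with density `r` on `B` and `s` on `Bᶜ`. -/
def twoStepMeasure (P : Measure Ω) [IsFiniteMeasure P] (B : Set Ω) (r s : ℝ) : SignedMeasure Ω :=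
  r • (P.restrict B).toSignedMeasure + s • (P.restrict Bᶜ).toSignedMeasure

theorem twoStepMeasure_apply_of_subset (P : Measure Ω) [IsFiniteMeasure P] {B C : Set Ω}
    (r s : ℝ) (hC : MeasurableSet C) (hCB : C ⊆ B) :
    (twoStepMeasure P B r s).toCharge.toFun C = r * P.real C := by
  change (twoStepMeasure P B r s) C = _
  rw [twoStepMeasure, add_apply, smul_apply, smul_apply,
    Measure.toSignedMeasure_apply_measurable hC, Measure.toSignedMeasure_apply_measurable hC,
    measureReal_restrict_apply hC, measureReal_restrict_apply hC, Set.inter_eq_left.2 hCB,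
    show C ∩ Bᶜ = ∅ from Set.sdiff_eq_empty.2 hCB]
  simp

theorem expect_twoStepMeasure (P : Measure Ω) [IsFiniteMeasure P] (B : Set Ω) (r s : ℝ)
    (X : BoundedRV Ω) :
    (twoStepMeasure P B r s).toCharge.expect X =
      r * ∫ ω in B, X.toFun ω ∂P + s * ∫ ω in Bᶜ, X.toFun ω ∂P := by
  rw [← BoundedCharge.expect_toSignedMeasure, ← BoundedCharge.expect_toSignedMeasure]
  exact BoundedCharge.expect_eq_of_forall_eq (fun _ _ => rfl) X

/-! ### The supremum of the lower supporting sets -/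

variable {P : Measure Ω} {D : Set (BoundedRV Ω)} {φ : D → ℝ}

/-- The members of `𝓛ᶠ` vanish on `P`-null sets. -/
theorem eq_zero_of_mem_lowerSuppFin (hne : D.Nonempty) (hD : IsInvariantSet P D)
    (hφ : IsInvariantFunctional P φ) {μ : BoundedCharge Ω} (hμ : μ ∈ lowerSuppFin φ)
    {N : Set Ω} (hN : MeasurableSet N) (hN0 : P N = 0) : μ.toFun N = 0 := by
  obtain ⟨X, hX⟩ := hne
  -- Adding `k` on a null set does not change the law of `X`, hence not the bound `φ`; as `k` is
  -- arbitrary, the coefficient `μ.toFun N` must vanish.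
  have key : ∀ k : ℝ, μ.expect X + k * μ.toFun N ≤ φ ⟨X, hX⟩ := fun k => by
    obtain ⟨C, hC⟩ := X.bounded'
    obtain ⟨C', hC'⟩ := (BoundedRV.step hN k 0).bounded'
    let Y : BoundedRV Ω := ⟨fun ω => X.toFun ω + (BoundedRV.step hN k 0).toFun ω,
      X.measurable'.add (BoundedRV.step hN k 0).measurable', C + C', fun ω =>
        (abs_add_le _ _).trans (add_le_add (hC ω) (hC' ω))⟩
    have hXY : EquiDistrib P X Y := by
      refine Measure.map_congr ?_
      filter_upwards [measure_eq_zero_iff_ae_notMem.1 hN0] with ω hω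
      simp [Y, BoundedRV.step_of_notMem hN k 0 hω]
    have hYD := hD X hX Y hXY
    have h := hμ ⟨Y, hYD⟩
    rw [← hφ ⟨X, hX⟩ ⟨Y, hYD⟩ hXY, μ.expect_add (fun _ => rfl : ∀ ω, Y.toFun ω = _),
      μ.expect_step] at h
    linarith
  by_contra h0
  have := key ((φ ⟨X, hX⟩ - μ.expect X + 1) / μ.toFun N)
  rw [div_mul_cancel₀ _ h0] at this
  linarith

variable [IsProbabilityMeasure P]

/-- Conditional averaging, followed by a rearrangement, maps `𝓛ᶠ` to `𝓛`. -/
theorem twoStepMeasure_mem_lowerSupp (hP : IsAtomless P) (hD : IsInvariantSet P D)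
    (hφ : IsInvariantFunctional P φ) {μ : BoundedCharge Ω} (hμ : μ ∈ lowerSuppFin φ)
    {A B : Set Ω} (hA : MeasurableSet A) (hB : MeasurableSet B) (hAB : P A = P B) :
    twoStepMeasure P B (μ.toFun A / P.real A) (μ.toFun Aᶜ / P.real Aᶜ) ∈ lowerSupp φ := by
  intro X
  rw [expect_twoStepMeasure]
  obtain ⟨K, hK⟩ := hP.exists_rearrangement hA hB hAB X.1
  obtain ⟨K', hK', hμK⟩ := μ.exists_abs_expect_sub_le
  have hABr : P.real A = P.real B := by rw [measureReal_def, hAB]; rfl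
  have hABc : P.real Aᶜ = P.real Bᶜ := by rw [probReal_compl_eq_one_sub hA,
    probReal_compl_eq_one_sub hB, hABr]
  rw [hABr, hABc]
  set x := (∫ ω in B, X.1.toFun ω ∂P) / P.real B with hx
  set y := (∫ ω in Bᶜ, X.1.toFun ω ∂P) / P.real Bᶜ with hy
  -- Averaging moves from the charge to `X`. For null `B` or `Bᶜ` the convention `x / 0 = 0` makes
  -- the corresponding terms vanish on both sides.
  have hlhs : μ.toFun A / P.real B * ∫ ω in B, X.1.toFun ω ∂P +
      μ.toFun Aᶜ / P.real Bᶜ * ∫ ω in Bᶜ, X.1.toFun ω ∂P = x * μ.toFun A + y * μ.toFun Aᶜ := by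
    rw [hx, hy]; ring
  rw [hlhs]
  by_contra! hlt
  -- For this `n`, `n` times the supposed gap exceeds the approximation error `|K| * K'`, which does
  -- not depend on `n`.
  obtain ⟨n, hn⟩ := exists_nat_gt (|K| * K' / (x * μ.toFun A + y * μ.toFun Aᶜ - φ X))
  have hn0 : 0 < n := by
    have : (0 : ℝ) < n := lt_of_le_of_lt (div_nonneg (by positivity) (by linarith)) hn
    exact_mod_cast this
  rw [div_lt_iff₀ (sub_pos.2 hlt)] at hn
  obtain ⟨Y, hXY, hYA, hYAc⟩ := hK n hn0
  have h1 : μ.expect (.sumRange Y n) ≤ n * φ X := by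
    rw [μ.expect_sumRange]
    calc _ ≤ ∑ i ∈ Finset.range n, φ X := Finset.sum_le_sum fun i _ => by
          have hYD : Y i ∈ D := hD X.1 X.2 _ (hXY i)
          exact (hμ ⟨Y i, hYD⟩).trans_eq (hφ X ⟨Y i, hYD⟩ (hXY i)).symm
      _ = n * φ X := by simp
  have h2 := hμK (.sumRange Y n) (.step hA (n * x) (n * y)) |K| (abs_nonneg _) fun ω => by
    refine le_trans ?_ (le_abs_self K)
    by_cases hω : ω ∈ A
    · rw [BoundedRV.step_of_mem hA _ _ hω]; exact hYA ω hω
    · rw [BoundedRV.step_of_notMem hA _ _ hω]; exact hYAc ω hω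
  rw [μ.expect_step] at h2
  have h3 := (abs_le.1 h2).1
  nlinarith

/-- An upper bound of `𝓛` dominates all conditional means of members of `𝓛ᶠ`. -/
theorem div_mul_measureReal_le (hP : IsAtomless P) (hD : IsInvariantSet P D)
    (hφ : IsInvariantFunctional P φ) {μ ρ : BoundedCharge Ω} (hμ : μ ∈ lowerSuppFin φ)
    (hρ : ∀ ν ∈ lowerSupp φ, ν.toCharge ≤ ρ) {A C : Set Ω} (hA : MeasurableSet A)
    (hA0 : 0 < P.real A) (hC : MeasurableSet C) :
    μ.toFun A / P.real A * P.real C ≤ ρ.toFun C := by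
  have small : ∀ C, MeasurableSet C → P.real C ≤ P.real A →
      μ.toFun A / P.real A * P.real C ≤ ρ.toFun C := by
    intro C hC hCA
    -- Enlarge `C` to a set of measure `P.real A`; the two-step measure of that set has density
    -- `μ.toFun A / P.real A` throughout `C`.
    obtain ⟨B, hB, hBC, hBr⟩ := hP.exists_measureReal_eq hC.compl (t := P.real A - P.real C)
      (sub_nonneg.2 hCA) (by
        rw [probReal_compl_eq_one_sub hC]
        linarith [measureReal_le_one (μ := P) (s := A)])
    have hr : P.real (C ∪ B) = P.real A := by
      rw [measureReal_union (Set.disjoint_of_subset_right hBC disjoint_compl_right) hB, hBr]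
      ring
    have hAB : P A = P (C ∪ B) :=
      ((ENNReal.toReal_eq_toReal_iff' (measure_ne_top _ _) (measure_ne_top _ _)).1 hr).symm
    have h := hρ _ (twoStepMeasure_mem_lowerSupp hP hD hφ hμ hA (hC.union hB) hAB) C hC
    rwa [twoStepMeasure_apply_of_subset P _ _ hC Set.subset_union_left] at h
  -- A larger `C` is cut into pieces of measure at most `P.real A`, and additivity of `ρ` sums the
  -- estimates.
  have key : ∀ (n : ℕ) (C : Set Ω), MeasurableSet C → P.real C ≤ n * P.real A →
      μ.toFun A / P.real A * P.real C ≤ ρ.toFun C := by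
    intro n
    induction n with
    | zero =>
      intro C hC hn
      refine small C hC (hn.trans ?_)
      simp
    | succ n ih =>
      intro C hC hn
      rcases le_total (P.real C) (P.real A) with h | h
      · exact small C hC h
      obtain ⟨B, hB, hBC, hBr⟩ := hP.exists_measureReal_eq hC hA0.le h
      have hd : P.real (C \ B) = P.real C - P.real A := by rw [measureReal_sdiff hBC hB, hBr]
      have h1 := small B hB hBr.le
      have h2 := ih (C \ B) (hC.diff hB) (by rw [hd]; push_cast at hn; linarith)
      have h3 := ρ.add' B (C \ B) hB (hC.diff hB) Set.disjoint_sdiff_right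
      rw [Set.union_sdiff_cancel hBC] at h3
      rw [h3]
      rw [hBr] at h1
      rw [hd] at h2
      linarith
  obtain ⟨n, hn⟩ := exists_nat_ge (1 / P.real A)
  rw [div_le_iff₀ hA0] at hn
  exact key n C hC (measureReal_le_one.trans hn)

/-- If `𝓛ᶠ` is nonempty and `𝓛` is bounded above in `ba`, then both have the same supremum, a
multiple of `P`. -/
theorem exists_isLUB_smul (hP : IsAtomless P) (hne : D.Nonempty) (hD : IsInvariantSet P D)
    (hφ : IsInvariantFunctional P φ) (hL : (lowerSuppFin φ).Nonempty) {ρ : BoundedCharge Ω}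
    (hρ : ∀ ν ∈ lowerSupp φ, ν.toCharge ≤ ρ) :
    ∃ a : ℝ, IsLUB (lowerSupp φ) (a • P.toSignedMeasure) ∧
      IsLUB (lowerSuppFin φ) (a • P.toSignedMeasure).toCharge := by
  let S : Set ℝ := {r | ∃ μ ∈ lowerSuppFin φ, ∃ A, MeasurableSet A ∧ 0 < P.real A ∧
    μ.toFun A / P.real A = r}
  have hSne : S.Nonempty := by
    obtain ⟨μ, hμ⟩ := hL
    exact ⟨_, μ, hμ, Set.univ, .univ, by simp, rfl⟩
  have hS : BddAbove S := by
    refine ⟨ρ.toFun Set.univ, ?_⟩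
    rintro _ ⟨μ, hμ, A, hA, hA0, rfl⟩
    simpa using div_mul_measureReal_le hP hD hφ hμ hρ hA hA0 .univ
  have hub : ∀ μ ∈ lowerSuppFin φ, μ ≤ (sSup S • P.toSignedMeasure).toCharge := by
    intro μ hμ A hA
    rw [toCharge_smul_toSignedMeasure_apply P _ hA]
    rcases (measureReal_nonneg (μ := P) (s := A)).eq_or_lt with h | h
    · rw [← h, mul_zero]
      exact (eq_zero_of_mem_lowerSuppFin hne hD hφ hμ hA
        ((measureReal_eq_zero_iff (measure_ne_top _ _)).1 h.symm)).le
    · rw [← div_le_iff₀ h]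
      exact le_csSup hS ⟨μ, hμ, A, hA, h, rfl⟩
  have hlub : ∀ τ : BoundedCharge Ω, (∀ ν ∈ lowerSupp φ, ν.toCharge ≤ τ) →
      (sSup S • P.toSignedMeasure).toCharge ≤ τ := by
    intro τ hτ C hC
    rw [toCharge_smul_toSignedMeasure_apply P _ hC]
    rcases (measureReal_nonneg (μ := P) (s := C)).eq_or_lt with h | h
    -- On a null `C` the claim is `0 ≤ τ.toFun C`, which any single ratio already gives.
    · obtain ⟨_, μ, hμ, A, hA, hA0, -⟩ := hSne
      simpa [← h] using div_mul_measureReal_le hP hD hφ hμ hτ hA hA0 hC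
    · rw [← le_div_iff₀ h]
      refine csSup_le hSne ?_
      rintro _ ⟨μ, hμ, A, hA, hA0, rfl⟩
      rw [le_div_iff₀ h]
      exact div_mul_measureReal_le hP hD hφ hμ hτ hA hA0 hC
  exact ⟨sSup S, ⟨fun ν hν => hub ν.toCharge hν, fun τ hτ => hlub τ.toCharge fun ν hν => hτ hν⟩,
    fun μ hμ => hub μ hμ, fun τ hτ => hlub τ fun ν hν => hτ hν⟩

/-- Neither `ba` nor `ca` has a least element, so the empty set has no supremum in either. This
forces `𝓛ᶠ` to be nonempty once one of the suprema exists. -/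
theorem exists_toCharge_not_ge (P : Measure Ω) [IsProbabilityMeasure P] (σ : BoundedCharge Ω) :
    ∃ ν : SignedMeasure Ω, ¬ σ ≤ ν.toCharge := by
  refine ⟨(σ.toFun Set.univ - 1) • P.toSignedMeasure, fun h => ?_⟩
  have := h Set.univ .univ
  rw [toCharge_smul_toSignedMeasure_apply P _ .univ] at this
  simp at this
  linarith

theorem lowerSupp_isLUB (hP : IsAtomless P) (hne : D.Nonempty) (hD : IsInvariantSet P D)
    (hφ : IsInvariantFunctional P φ) :
    ((∃ σ : BoundedCharge Ω, IsLUB (lowerSuppFin φ) σ) ↔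
        ∃ σ : SignedMeasure Ω, IsLUB (lowerSupp φ) σ) ∧
      ((∃ σ : SignedMeasure Ω, IsLUB (lowerSupp φ) σ) →
        ∃ a : ℝ, IsLUB (lowerSupp φ) (a • P.toSignedMeasure) ∧
          IsLUB (lowerSuppFin φ) (a • P.toSignedMeasure).toCharge) := by
  have hca : (∃ σ : SignedMeasure Ω, IsLUB (lowerSupp φ) σ) →
      ∃ a : ℝ, IsLUB (lowerSupp φ) (a • P.toSignedMeasure) ∧
        IsLUB (lowerSuppFin φ) (a • P.toSignedMeasure).toCharge := by
    rintro ⟨σ, hσ⟩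
    refine exists_isLUB_smul hP hne hD hφ ?_ (ρ := σ.toCharge) fun ν hν => hσ.1 hν
    -- If `𝓛ᶠ` were empty, so would be its subset `𝓛`, and `σ` would be a least element of `ca`.
    by_contra h
    obtain ⟨τ, hτ⟩ := exists_toCharge_not_ge P σ.toCharge
    exact hτ (hσ.2 fun ν hν => (h ⟨ν.toCharge, hν⟩).elim)
  refine ⟨⟨?_, fun h => ?_⟩, hca⟩
  · rintro ⟨σ, hσ⟩
    obtain ⟨a, ha, -⟩ := exists_isLUB_smul hP hne hD hφ (by
      by_contra h
      obtain ⟨τ, hτ⟩ := exists_toCharge_not_ge P σ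
      exact hτ (hσ.2 fun ν hν => (h ⟨ν, hν⟩).elim)) (ρ := σ) fun ν hν => hσ.1 hν
    exact ⟨_, ha⟩
  · obtain ⟨a, -, ha⟩ := hca h
    exact ⟨_, ha⟩

/-! ### Reduction of the upper supporting sets to the lower ones by negation -/

namespace BoundedCharge

instance : InvolutiveNeg (BoundedCharge Ω) where
  neg μ :=
    { toFun := fun A => -μ.toFun A
      not_measurable' := fun A hA => by rw [μ.not_measurable' A hA, neg_zero]
      add' := fun A B hA hB hd => by rw [μ.add' A B hA hB hd, neg_add]
      bounded' := by simpa only [abs_neg] using μ.bounded' }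
  neg_neg μ := BoundedCharge.ext (funext fun A => neg_neg (μ.toFun A))

theorem neg_le_iff {μ ν : BoundedCharge Ω} : -μ ≤ ν ↔ -ν ≤ μ :=
  forall₂_congr fun A _ => by
    change -μ.toFun A ≤ ν.toFun A ↔ -ν.toFun A ≤ μ.toFun A
    exact neg_le

theorem le_neg_iff {μ ν : BoundedCharge Ω} : μ ≤ -ν ↔ ν ≤ -μ :=
  forall₂_congr fun A _ => by
    change μ.toFun A ≤ -ν.toFun A ↔ ν.toFun A ≤ -μ.toFun A
    exact le_neg

theorem expect_neg (μ : BoundedCharge Ω) (X : BoundedRV Ω) : (-μ).expect X = -μ.expect X := by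
  have := expect_eq_of_forall_eq (ρ := -μ) (μ := μ) (ν := μ) (r := -1) (s := 0)
    (fun A _ => by change -μ.toFun A = _; ring) X
  rw [this]
  ring

end BoundedCharge

theorem MeasureTheory.SignedMeasure.toCharge_neg (μ : SignedMeasure Ω) :
    (-μ).toCharge = -μ.toCharge :=
  BoundedCharge.ext rfl

theorem MeasureTheory.SignedMeasure.neg_le_iff {μ ν : SignedMeasure Ω} : -μ ≤ ν ↔ -ν ≤ μ := by
  rw [← toCharge_le_toCharge, ← toCharge_le_toCharge, toCharge_neg, toCharge_neg]
  exact BoundedCharge.neg_le_iff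

theorem MeasureTheory.SignedMeasure.le_neg_iff {μ ν : SignedMeasure Ω} : μ ≤ -ν ↔ ν ≤ -μ := by
  rw [← toCharge_le_toCharge, ← toCharge_le_toCharge, toCharge_neg, toCharge_neg]
  exact BoundedCharge.le_neg_iff

theorem neg_mem_lowerSuppFin_neg {μ : BoundedCharge Ω} :
    -μ ∈ lowerSuppFin (-φ) ↔ μ ∈ upperSuppFin φ :=
  forall_congr' fun X => by
    rw [μ.expect_neg]
    exact neg_le_neg_iff

theorem neg_mem_lowerSupp_neg {μ : SignedMeasure Ω} :
    -μ ∈ lowerSupp (-φ) ↔ μ ∈ upperSupp φ :=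
  forall_congr' fun X => by
    rw [μ.toCharge_neg, BoundedCharge.expect_neg]
    exact neg_le_neg_iff

/-- Negation reverses the order and carries the upper supporting set of `φ` onto the lower one of
`-φ`. -/
theorem isGLB_upperSuppFin_neg {σ : BoundedCharge Ω} :
    IsGLB (upperSuppFin φ) (-σ) ↔ IsLUB (lowerSuppFin (-φ)) σ := by
  refine and_congr ⟨fun h μ hμ => ?_, fun h μ hμ => ?_⟩ ⟨fun h τ hτ => ?_, fun h τ hτ => ?_⟩
  · rw [← neg_neg μ, neg_mem_lowerSuppFin_neg] at hμ
    rw [← neg_neg μ, BoundedCharge.neg_le_iff]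
    exact h hμ
  · rw [BoundedCharge.neg_le_iff]
    exact h (neg_mem_lowerSuppFin_neg.2 hμ)
  · rw [← neg_neg σ, BoundedCharge.neg_le_iff]
    refine h fun μ hμ => ?_
    rw [BoundedCharge.neg_le_iff]
    exact hτ (neg_mem_lowerSuppFin_neg.2 hμ)
  · rw [BoundedCharge.le_neg_iff]
    refine h fun μ hμ => ?_
    rw [← neg_neg μ, neg_mem_lowerSuppFin_neg] at hμ
    rw [BoundedCharge.le_neg_iff]
    exact hτ hμ

theorem isGLB_upperSupp_neg {σ : SignedMeasure Ω} :
    IsGLB (upperSupp φ) (-σ) ↔ IsLUB (lowerSupp (-φ)) σ := by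
  refine and_congr ⟨fun h μ hμ => ?_, fun h μ hμ => ?_⟩ ⟨fun h τ hτ => ?_, fun h τ hτ => ?_⟩
  · rw [← neg_neg μ, neg_mem_lowerSupp_neg] at hμ
    rw [← neg_neg μ, SignedMeasure.neg_le_iff]
    exact h hμ
  · rw [SignedMeasure.neg_le_iff]
    exact h (neg_mem_lowerSupp_neg.2 hμ)
  · rw [← neg_neg σ, SignedMeasure.neg_le_iff]
    refine h fun μ hμ => ?_
    rw [SignedMeasure.neg_le_iff]
    exact hτ (neg_mem_lowerSupp_neg.2 hμ)
  · rw [SignedMeasure.le_neg_iff]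
    refine h fun μ hμ => ?_
    rw [← neg_neg μ, neg_mem_lowerSupp_neg] at hμ
    rw [SignedMeasure.le_neg_iff]
    exact hτ hμ

end

theorem mainTheorem4 {Ω : Type*} [MeasurableSpace Ω] (P : Measure Ω) [IsProbabilityMeasure P]
    (hP : IsAtomless P) (D : Set (BoundedRV Ω)) (hD_ne : D.Nonempty) (hD : IsInvariantSet P D)
    (φ : D → ℝ) (hφ : IsInvariantFunctional P φ) :
    (((∃ σ : BoundedCharge Ω, IsLUB (lowerSuppFin φ) σ) ↔
          ∃ σ : SignedMeasure Ω, IsLUB (lowerSupp φ) σ) ∧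
        ((∃ σ : SignedMeasure Ω, IsLUB (lowerSupp φ) σ) →
          ∃ a : ℝ, IsLUB (lowerSupp φ) (a • P.toSignedMeasure) ∧
            IsLUB (lowerSuppFin φ) (a • P.toSignedMeasure).toCharge)) ∧
      (((∃ σ : BoundedCharge Ω, IsGLB (upperSuppFin φ) σ) ↔
          ∃ σ : SignedMeasure Ω, IsGLB (upperSupp φ) σ) ∧
        ((∃ σ : SignedMeasure Ω, IsGLB (upperSupp φ) σ) →
          ∃ b : ℝ, IsGLB (upperSupp φ) (b • P.toSignedMeasure) ∧
            IsGLB (upperSuppFin φ) (b • P.toSignedMeasure).toCharge)) := by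
  refine ⟨lowerSupp_isLUB hP hD_ne hD hφ, ?_⟩
  obtain ⟨h1, h2⟩ := lowerSupp_isLUB (φ := -φ) hP hD_ne hD
    fun X Y h => congrArg Neg.neg (hφ X Y h)
  have hfin : (∃ σ : BoundedCharge Ω, IsGLB (upperSuppFin φ) σ) ↔
      ∃ σ : BoundedCharge Ω, IsLUB (lowerSuppFin (-φ)) σ :=
    neg_surjective.exists.trans (exists_congr fun _ => isGLB_upperSuppFin_neg)
  have hca : (∃ σ : SignedMeasure Ω, IsGLB (upperSupp φ) σ) ↔
      ∃ σ : SignedMeasure Ω, IsLUB (lowerSupp (-φ)) σ :=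
    neg_surjective.exists.trans (exists_congr fun _ => isGLB_upperSupp_neg)
  refine ⟨hfin.trans (h1.trans hca.symm), fun h => ?_⟩
  obtain ⟨a, ha, ha'⟩ := h2 (hca.1 h)
  have hneg : (-a) • P.toSignedMeasure = -(a • P.toSignedMeasure) := by
    ext A hA
    exact neg_mul a _
  refine ⟨-a, ?_, ?_⟩
  · rw [hneg]
    exact isGLB_upperSupp_neg.2 ha
  · rw [hneg, SignedMeasure.toCharge_neg]
    exact isGLB_upperSuppFin_neg.2 ha'
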